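/- Theorem 5.1 (Effective de Moivre–Laplace central limit theorem). Let $0<p<1$ be a computable real number, and let $X_1,X_2,\dots$ be independent $\{0,1\}$-valued random variables on a probability space $(\Omega,\mathcal B,\mathbb P)$ with $\mathbb P(X_n=1)=p$ and $\mathbb P(X_n=0)=1-p$ for every $n$. For $m\ge 1$ let $\mu_m$ be the probability distribution of $$Y_m=\frac{X_1+\cdots+X_m-mp}{\sqrt{mp(1-p)}}.$$ Then $\{\mu_m\}$ converges effectively to the standard Gaussian distribution $\mu=N(0,1)$. That is: for every computable sequence $\{f_n\}$ of functions $f_n:\mathbb R\to\mathbb R$ with compact support there is a recursive function $\alpha:\mathbb N^2\to\mathbb N$ such that, for all $n,k$ and all $m\ge\max(1,\alpha(n,k))$, $$\left|\int_{\mathbb R} f_n\,d\mu_m-\int_{\mathbb R} f_n\,d\mu\right|<2^{-k}.$$ Here a real $x$ is computable if there is a computable sequence of rationals $\{r_k\}$ with $|r_k-x|\le 2^{-k}$ for all $k$, and a sequence $\{x_i\}$ of reals (with $i$ in $\mathbb N$ or $\mathbb N^2$) is computable if there is a computable family of rationals $\{r_{i,k}\}$ with $|r_{i,k}-x_i|\le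 2^{-k}$ for all $i,k$; a family of rationals is computable if it has the form $(-1)^{s}a/b$ with recursive $\mathbb N$-valued functions $s,a,b$ of the index, $b\neq0$. A sequence $\{f_n\}$ of functions is computable with compact support if (i) $\{f_n(x_m)\}_{n,m}$ is computable for every computable sequence of reals $\{x_m\}$; (ii) there is a recursive $\beta$ such that $|f_n(x)-f_n(y)|<2^{-k}$ whenever $|x|,|y|\le L$ and $|x-y|<2^{-\beta(n,L,k)}$, for $n,L,k\in\mathbb N$; and (iii) there is a recursive $\rho:\mathbb N\to\mathbb N$ such that $f_n(x)=0$ whenever $|x|\ge \rho(n)$. -/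

import Mathlib

open MeasureTheory ProbabilityTheory

/-- A family of rationals indexed by a (primcodable) type is computable if it can be written as
`(-1) ^ s * a / b` with recursive `s, a, b` and `b` nowhere zero. -/
def IsComputableRat {ι : Type*} [Primcodable ι] (r : ι → ℚ) : Prop :=
  ∃ s a b : ι → ℕ, Computable s ∧ Computable a ∧ Computable b ∧
    ∀ i, b i ≠ 0 ∧ r i = (-1) ^ s i * ((a i : ℚ) / (b i : ℚ))

/-- A computable real number: the limit of a computable sequence of rationals with error at most
`2 ^ (-k)` at stage `k`. -/
def IsComputableReal (x : ℝ) : Prop :=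
  ∃ r : ℕ → ℚ, IsComputableRat r ∧ ∀ k, |(r k : ℝ) - x| ≤ (2 : ℝ)⁻¹ ^ k

/-- A computable family of reals (for `ι = ℕ` a computable sequence, for `ι = ℕ × ℕ` a computable
double sequence): the rational approximations are computable uniformly in the index. -/
def IsComputableRealFamily {ι : Type*} [Primcodable ι] (x : ι → ℝ) : Prop :=
  ∃ r : ι × ℕ → ℚ, IsComputableRat r ∧ ∀ i k, |(r (i, k) : ℝ) - x i| ≤ (2 : ℝ)⁻¹ ^ k

/-- A computable sequence of functions on `ℝ`, in the sense of Pour-El and Richards: sequential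
computability together with effective continuity. -/
structure IsComputableFunSeq (f : ℕ → ℝ → ℝ) : Prop where
  sequentially_computable : ∀ x : ℕ → ℝ, IsComputableRealFamily x →
    IsComputableRealFamily (fun i : ℕ × ℕ => f i.1 (x i.2))
  effectively_continuous : ∃ α : ℕ × ℕ × ℕ → ℕ, Computable α ∧
    ∀ (n L k : ℕ) (x y : ℝ), |x| ≤ L → |y| ≤ L → |x - y| < (2 : ℝ)⁻¹ ^ α (n, L, k) →
      |f n x - f n y| < (2 : ℝ)⁻¹ ^ k

/-- A computable sequence of functions with (recursively bounded) compact supports. -/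
def IsComputableFunSeqWithCompactSupport (f : ℕ → ℝ → ℝ) : Prop :=
  IsComputableFunSeq f ∧
    ∃ L : ℕ → ℕ, Computable L ∧ ∀ (n : ℕ) (x : ℝ), (L n : ℝ) ≤ |x| → f n x = 0

/-- Effective convergence of a sequence of probability distributions on `ℝ`. -/
def ConvergesEffectively (μ : ℕ → Measure ℝ) (ν : Measure ℝ) : Prop :=
  ∀ f : ℕ → ℝ → ℝ, IsComputableFunSeqWithCompactSupport f →
    ∃ α : ℕ × ℕ → ℕ, Computable α ∧ ∀ n k m : ℕ, α (n, k) ≤ m →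
      |(∫ x, f n x ∂(μ m)) - ∫ x, f n x ∂ν| < (2 : ℝ)⁻¹ ^ k

/-- `X 0, X 1, …` is a realization of coin tossing with success probability `p`. -/
structure IsCoinTossing {Ω : Type*} [MeasurableSpace Ω] (P : Measure Ω) (X : ℕ → Ω → ℝ)
    (p : ℝ) : Prop where
  measurable : ∀ n, Measurable (X n)
  mem_zero_one : ∀ n ω, X n ω = 0 ∨ X n ω = 1
  prob_one : ∀ n, P {ω | X n ω = 1} = ENNReal.ofReal p
  prob_zero : ∀ n, P {ω | X n ω = 0} = ENNReal.ofReal (1 - p)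
  indep : iIndepFun X P

/-- The normalized sum of the first `m` tosses (meaningful for `m ≥ 1` and `0 < p < 1`). -/
noncomputable def normalizedSum {Ω : Type*} (X : ℕ → Ω → ℝ) (p : ℝ) (m : ℕ) (ω : Ω) : ℝ :=
  ((∑ l ∈ Finset.range m, X l ω) - m * p) / √(m * p * (1 - p))

/-! Lindeberg's replacement method, with every constant explicit. Three moving averages of width `s`
turn a test function `f` with `|f| ≤ M` into a function `h` whose third derivative is at most `8 * M
/ s ^ 3`, and which stays within the oscillation `ε` of `f` at scale `3 * s`. Each normalized toss
has mean `0` and variance `1 / m`, like a Gaussian of that variance, so swapping one for the other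
changes the integral of `h` only by third-order Taylor terms, of size `m ^ (-3/2)`. The `m` swaps of
`abs_integral_conv_pow_sub_le` thus cost a multiple of `1 / √m`, and the total error for `f` is at
most `2 * ε + 8 * M / s ^ 3 * C / √m`.

Here `C` depends on `p` alone, so one natural number above it serves all test functions. The scale
`s` and the bound `M` come recursively from the modulus of continuity and the support radius, and so
does a sufficient `m`. -/

/-! ### Smoothing by moving averages -/

/-- The average of `f` over the window `[x, x + s]`. -/
noncomputable def movingAverage (s : ℝ) (f : ℝ → ℝ) (x : ℝ) : ℝ :=
  s⁻¹ * ∫ y in x..x + s, f y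

/-- The difference quotient of `f` with step `s`. -/
noncomputable def diffQuotient (s : ℝ) (f : ℝ → ℝ) (x : ℝ) : ℝ :=
  s⁻¹ * (f (x + s) - f x)

/-- Averaging trades a derivative for a difference quotient, which is bounded even when `f` is
merely continuous and bounded. -/
lemma hasDerivAt_movingAverage {f : ℝ → ℝ} (hf : Continuous f) (s x : ℝ) :
    HasDerivAt (movingAverage s f) (diffQuotient s f x) x := by
  have key : movingAverage s f =
      fun x => s⁻¹ * ((∫ y in (0 : ℝ)..x + s, f y) - ∫ y in (0 : ℝ)..x, f y) := by
    funext x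
    rw [movingAverage, intervalIntegral.integral_interval_sub_left] <;>
      exact hf.intervalIntegrable _ _
  have hF (u : ℝ) : HasDerivAt (fun x => ∫ y in (0 : ℝ)..x, f y) (f u) u :=
    hf.integral_hasStrictDerivAt 0 u |>.hasDerivAt
  rw [key]
  exact (((hF (x + s)).comp_add_const x s).sub (hF x)).const_mul _

lemma hasDerivAt_diffQuotient {g g' : ℝ → ℝ} (hg : ∀ x, HasDerivAt g (g' x) x) (s x : ℝ) :
    HasDerivAt (diffQuotient s g) (diffQuotient s g' x) x :=
  (((hg (x + s)).comp_add_const x s).sub (hg x)).const_mul _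

lemma continuous_movingAverage {f : ℝ → ℝ} (hf : Continuous f) (s : ℝ) :
    Continuous (movingAverage s f) :=
  continuous_iff_continuousAt.2 fun x => (hasDerivAt_movingAverage hf s x).continuousAt

lemma abs_movingAverage_sub_le {f : ℝ → ℝ} (hf : Continuous f) {s : ℝ} (hs : 0 < s) {x c ε : ℝ}
    (h : ∀ y ∈ Set.Icc x (x + s), |f y - c| ≤ ε) : |movingAverage s f x - c| ≤ ε := by
  have key : movingAverage s f x - c = s⁻¹ * ∫ y in x..x + s, (f y - c) := by
    rw [intervalIntegral.integral_sub (hf.intervalIntegrable _ _)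
      (continuous_const.intervalIntegrable _ _), intervalIntegral.integral_const, movingAverage]
    simp only [add_sub_cancel_left, smul_eq_mul]
    field_simp
  have hb : ‖∫ y in x..x + s, (f y - c)‖ ≤ ε * |x + s - x| := by
    refine intervalIntegral.norm_integral_le_of_norm_le_const fun y hy => ?_
    rw [Set.uIoc_of_le (by linarith)] at hy
    exact h y ⟨hy.1.le, hy.2⟩
  rw [Real.norm_eq_abs, add_sub_cancel_left, abs_of_pos hs] at hb
  rw [key, abs_mul, abs_of_pos (inv_pos.2 hs), inv_mul_le_iff₀ hs]
  linarith

lemma abs_diffQuotient_le {g : ℝ → ℝ} {B : ℝ} (hg : ∀ x, |g x| ≤ B) {s : ℝ} (hs : 0 < s) (x : ℝ) :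
    |diffQuotient s g x| ≤ 2 / s * B := by
  rw [diffQuotient, abs_mul, abs_of_pos (inv_pos.2 hs)]
  calc s⁻¹ * |g (x + s) - g x| ≤ s⁻¹ * (B + B) := by
        gcongr
        exact (abs_sub _ _).trans (add_le_add (hg _) (hg _))
    _ = 2 / s * B := by ring

/-- A bound for the remainder of the second order Taylor expansion of a function at every point. -/
def HasCubicRemainder (B : ℝ) (h h₁ h₂ : ℝ → ℝ) : Prop :=
  ∀ x t, |h (x + t) - (h x + t * h₁ x + t ^ 2 / 2 * h₂ x)| ≤ B * |t| ^ 3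

/-- Three mean value estimates, descending from `h₂` to `h`, each gain a factor `|t|`. The factor `1
/ 6` of Taylor's formula is given up for simplicity. -/
lemma hasCubicRemainder_of_hasDerivAt {h h₁ h₂ h₃ : ℝ → ℝ} {B : ℝ}
    (d₁ : ∀ x, HasDerivAt h (h₁ x) x) (d₂ : ∀ x, HasDerivAt h₁ (h₂ x) x)
    (d₃ : ∀ x, HasDerivAt h₂ (h₃ x) x) (hB : ∀ x, |h₃ x| ≤ B) : HasCubicRemainder B h h₁ h₂ := by
  intro x t
  have hB0 : 0 ≤ B := (abs_nonneg _).trans (hB 0)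
  have mvt {g g' : ℝ → ℝ} {C u : ℝ} (hg : ∀ v, HasDerivAt g (g' v) v)
      (hC : ∀ v, |v| ≤ |u| → |g' v| ≤ C) : |g u - g 0| ≤ C * |u| := by
    have := (convex_Icc (-|u|) |u|).norm_image_sub_le_of_norm_hasDerivWithin_le
      (f := g) (f' := g') (C := C) (x := 0) (y := u)
      (fun v _ => (hg v).hasDerivWithinAt) (fun v hv => hC v (abs_le.2 hv))
      ⟨by simp, by simp⟩ (abs_le.1 le_rfl)
    simpa using this
  have e₂ (v : ℝ) : |h₂ (x + v) - h₂ x| ≤ B * |v| := by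
    simpa using mvt (g := fun v => h₂ (x + v)) (u := v)
      (fun v => (d₃ (x + v)).comp_const_add x v) (fun v _ => hB _)
  have e₁ (v : ℝ) : |h₁ (x + v) - (h₁ x + v * h₂ x)| ≤ B * |v| * |v| := by
    have := mvt (g := fun v => h₁ (x + v) - v * h₂ x) (g' := fun v => h₂ (x + v) - 1 * h₂ x)
      (u := v) (C := B * |v|)
      (fun v => ((d₂ (x + v)).comp_const_add x v).sub ((hasDerivAt_id v).mul_const _))
      (fun w hw => by rw [one_mul]; exact (e₂ w).trans (by gcongr))
    simp only [zero_mul, sub_zero, add_zero] at this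
    convert this using 2
    ring
  have := mvt (g := fun v => h (x + v) - (v * h₁ x + v ^ 2 / 2 * h₂ x))
    (g' := fun v => h₁ (x + v) - (1 * h₁ x + (2 * v) / 2 * h₂ x))
    (u := t) (C := B * |t| * |t|)
    (fun v => ((d₁ (x + v)).comp_const_add x v).sub (((hasDerivAt_id v).mul_const _).add
      (((by simpa using hasDerivAt_pow 2 v : HasDerivAt (fun v : ℝ => v ^ 2) (2 * v) v).div_const
        2).mul_const _)))
    (fun w hw => by
      have h1 : h₁ (x + w) - (1 * h₁ x + (2 * w) / 2 * h₂ x)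
        = h₁ (x + w) - (h₁ x + w * h₂ x) := by ring
      rw [h1]
      exact (e₁ w).trans (by gcongr))
  simp only [zero_mul, sub_zero, add_zero, ne_eq, OfNat.ofNat_ne_zero, not_false_eq_true, zero_pow,
    zero_div] at this
  convert this using 1
  · congr 1; ring
  · ring

/-- A bounded continuous function is approximated, up to its oscillation on the scale `3 * s`, by a
bounded function whose second order Taylor expansion has a controlled remainder. -/
lemma exists_hasCubicRemainder_approx {f : ℝ → ℝ} (hf : Continuous f) {M s ε : ℝ} (hs : 0 < s)
    (hM : ∀ x, |f x| ≤ M) (hε : ∀ x y, |x - y| ≤ 3 * s → |f x - f y| ≤ ε) :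
    ∃ h h₁ h₂ : ℝ → ℝ, Continuous h ∧ (∀ x, |h x| ≤ M) ∧ (∀ x, |h x - f x| ≤ ε) ∧
      HasCubicRemainder (8 * M / s ^ 3) h h₁ h₂ := by
  have c₁ := continuous_movingAverage hf s
  have c₂ := continuous_movingAverage c₁ s
  have bound {g : ℝ → ℝ} (hg : Continuous g) (h : ∀ x, |g x| ≤ M) (x : ℝ) :
      |movingAverage s g x| ≤ M := by
    simpa using abs_movingAverage_sub_le hg hs (x := x) (c := 0) (fun y _ => by simpa using h y)
  refine ⟨movingAverage s (movingAverage s (movingAverage s f)),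
    diffQuotient s (movingAverage s (movingAverage s f)),
    diffQuotient s (diffQuotient s (movingAverage s f)), continuous_movingAverage c₂ s,
    bound c₂ (bound c₁ (bound hf hM)), fun x => ?_, ?_⟩
  -- The three nested windows only reach points of `[x, x + 3 * s]`.
  · refine abs_movingAverage_sub_le c₂ hs fun y hy => abs_movingAverage_sub_le c₁ hs fun z hz =>
      abs_movingAverage_sub_le hf hs fun w hw => hε w x ?_
    rw [abs_le]
    constructor <;> linarith [hy.1, hy.2, hz.1, hz.2, hw.1, hw.2]
  · refine hasCubicRemainder_of_hasDerivAt (h₃ := diffQuotient s (diffQuotient s (diffQuotient s f)))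
      (hasDerivAt_movingAverage c₂ s)
      (hasDerivAt_diffQuotient (hasDerivAt_movingAverage c₁ s) s)
      (hasDerivAt_diffQuotient (hasDerivAt_diffQuotient (hasDerivAt_movingAverage hf s) s) s)
      fun x => ?_
    refine (abs_diffQuotient_le (abs_diffQuotient_le (abs_diffQuotient_le hM hs) hs) hs x).trans_eq
      ?_
    field_simp
    ring

/-! ### Taylor expansion under the integral and replacement -/

lemma integrable_comp_const_add {h : ℝ → ℝ} (hc : Continuous h) {M : ℝ} (hM : ∀ x, |h x| ≤ M)
    (μ : Measure ℝ) [IsFiniteMeasure μ] (x : ℝ) : Integrable (fun y => h (x + y)) μ :=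
  Integrable.of_bound (by fun_prop) M (.of_forall fun y => hM _)

/-- The linear term vanishes, so two centred laws of equal variance share the same main term, which
cancels when they are compared. -/
lemma abs_integral_sub_le_of_hasCubicRemainder {h h₁ h₂ : ℝ → ℝ} {B M : ℝ} (hc : Continuous h)
    (hM : ∀ x, |h x| ≤ M) (hB : HasCubicRemainder B h h₁ h₂) {μ : Measure ℝ}
    [IsProbabilityMeasure μ] (hμ : MemLp id 3 μ) (mean : ∫ y, y ∂μ = 0) (x : ℝ) :
    |∫ y, h (x + y) ∂μ - (h x + (∫ y, y ^ 2 ∂μ) / 2 * h₂ x)| ≤ B * ∫ y, |y| ^ 3 ∂μ := by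
  have i1 : Integrable (fun y : ℝ => y) μ :=
    (hμ.mono_exponent (p := 1) (by norm_num)).integrable le_rfl
  have i2 : Integrable (fun y : ℝ => y ^ 2) μ :=
    (hμ.mono_exponent (p := 2) (by norm_num)).integrable_sq
  have i3 : Integrable (fun y : ℝ => |y| ^ 3) μ := by
    simpa using hμ.integrable_norm_pow (p := 3) (by norm_num)
  have iT : Integrable (fun y => h x + y * h₁ x + y ^ 2 / 2 * h₂ x) μ :=
    ((integrable_const _).add (i1.mul_const _)).add ((i2.div_const _).mul_const _)
  have e : ∫ y, (h x + y * h₁ x + y ^ 2 / 2 * h₂ x) ∂μ = h x + (∫ y, y ^ 2 ∂μ) / 2 * h₂ x := by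
    have i0 : Integrable (fun y => h x + y * h₁ x) μ := (integrable_const _).add (i1.mul_const _)
    rw [integral_add i0 ((i2.div_const _).mul_const _),
      integral_add (integrable_const _) (i1.mul_const _), integral_mul_const, integral_mul_const,
      integral_div, mean]
    simp
  rw [← e, ← integral_sub (integrable_comp_const_add hc hM μ x) iT, ← integral_const_mul]
  exact norm_integral_le_of_norm_le
    (f := fun y => h (x + y) - (h x + y * h₁ x + y ^ 2 / 2 * h₂ x)) (i3.const_mul B)
    (.of_forall fun y => hB x y)

lemma integral_conv_of_bounded {h : ℝ → ℝ} (hc : Continuous h) {M : ℝ} (hM : ∀ x, |h x| ≤ M)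
    (μ ν : Measure ℝ) [IsProbabilityMeasure μ] [IsProbabilityMeasure ν] :
    ∫ z, h z ∂(μ ∗ ν) = ∫ x, ∫ y, h (x + y) ∂ν ∂μ := by
  rw [Measure.conv, integral_map (by fun_prop) hc.aestronglyMeasurable]
  exact integral_prod _ (Integrable.of_bound (by fun_prop) M (.of_forall fun y => hM _))

lemma continuous_integral_comp_add {h : ℝ → ℝ} (hc : Continuous h) {M : ℝ} (hM : ∀ x, |h x| ≤ M)
    (μ : Measure ℝ) [IsFiniteMeasure μ] : Continuous fun x => ∫ y, h (x + y) ∂μ :=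
  continuous_of_dominated (bound := fun _ => M) (fun x => by fun_prop)
    (fun x => .of_forall fun y => hM _) (integrable_const _)
    (.of_forall fun y => by fun_prop)

lemma abs_integral_comp_add_le {h : ℝ → ℝ} {M : ℝ} (hM : ∀ x, |h x| ≤ M)
    (μ : Measure ℝ) [IsProbabilityMeasure μ] (x : ℝ) : |∫ y, h (x + y) ∂μ| ≤ M := by
  simpa using norm_integral_le_of_norm_le_const (μ := μ) (f := fun y => h (x + y)) (C := M)
    (.of_forall fun y => hM _)

lemma abs_integral_sub_integral_le {g₁ g₂ : ℝ → ℝ} {ε : ℝ} {μ : Measure ℝ} [IsProbabilityMeasure μ]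
    (h₁ : Integrable g₁ μ) (h₂ : Integrable g₂ μ) (h : ∀ x, |g₁ x - g₂ x| ≤ ε) :
    |∫ x, g₁ x ∂μ - ∫ x, g₂ x ∂μ| ≤ ε := by
  rw [← integral_sub h₁ h₂]
  simpa using norm_integral_le_of_norm_le_const (μ := μ) (f := fun x => g₁ x - g₂ x)
    (C := ε) (.of_forall h)

/-- Lindeberg's replacement argument: if convolution with `ν` and with `γ` differ by at most `ε` on
`h`, then convolution with their `m`-th convolution powers differs by at most `m * ε`. -/
lemma abs_integral_conv_pow_sub_le {h : ℝ → ℝ} (hc : Continuous h) {M ε : ℝ}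
    (hM : ∀ x, |h x| ≤ M) {S G ν γ : ℕ → Measure ℝ} [∀ k, IsProbabilityMeasure (S k)]
    [∀ k, IsProbabilityMeasure (G k)] [∀ k, IsProbabilityMeasure (ν k)]
    [∀ k, IsProbabilityMeasure (γ k)] (h0 : S 0 = G 0) (hS : ∀ k, S (k + 1) = S k ∗ ν k)
    (hG : ∀ k, G (k + 1) = G k ∗ γ k)
    (hε : ∀ k x, |∫ y, h (x + y) ∂(ν k) - ∫ y, h (x + y) ∂(γ k)| ≤ ε) (m : ℕ) (x : ℝ) :
    |∫ y, h (x + y) ∂(S m) - ∫ y, h (x + y) ∂(G m)| ≤ m * ε := by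
  induction m generalizing x with
  | zero => simp [h0]
  | succ m ih =>
    have hx : Continuous fun y => h (x + y) := by fun_prop
    have hMx : ∀ y, |h (x + y)| ≤ M := fun y => hM _
    -- Commuting the convolution puts the common factor `γ m` outside; the induction hypothesis then
    -- applies at the shifted point `x + b`, hence the generalization over `x`.
    have hsw (μ : Measure ℝ) [IsProbabilityMeasure μ] :
        ∫ z, h (x + z) ∂(μ ∗ γ m) = ∫ b, ∫ a, h (x + b + a) ∂μ ∂(γ m) := by
      rw [Measure.conv_comm, integral_conv_of_bounded hx hMx]
      simp only [add_assoc]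
    have hint (μ ρ : Measure ℝ) [IsProbabilityMeasure μ] [IsProbabilityMeasure ρ] :
        Integrable (fun a => ∫ b, h (x + a + b) ∂μ) ρ :=
      integrable_comp_const_add (continuous_integral_comp_add hc hM μ)
        (abs_integral_comp_add_le hM μ) ρ x
    have s₁ : |∫ y, h (x + y) ∂(S (m + 1)) - ∫ y, h (x + y) ∂(S m ∗ γ m)| ≤ ε := by
      rw [hS, integral_conv_of_bounded hx hMx, integral_conv_of_bounded hx hMx]
      simp only [← add_assoc]
      exact abs_integral_sub_integral_le (hint _ _) (hint _ _) fun a => hε m _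
    have s₂ : |∫ y, h (x + y) ∂(S m ∗ γ m) - ∫ y, h (x + y) ∂(G (m + 1))| ≤ m * ε := by
      rw [hG, hsw, hsw]
      exact abs_integral_sub_integral_le (hint _ _) (hint _ _) fun b => ih _
    calc _ ≤ _ := abs_sub_le _ (∫ y, h (x + y) ∂(S m ∗ γ m)) _
      _ ≤ ε + m * ε := add_le_add s₁ s₂
      _ = _ := by push_cast; ring

/-! ### Moments of the Gaussian and of the tosses -/

lemma integral_sq_gaussianReal (v : NNReal) : ∫ y, y ^ 2 ∂(gaussianReal 0 v) = v := by
  have := variance_fun_id_gaussianReal (μ := 0) (v := v)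
  rwa [variance_of_integral_eq_zero (by fun_prop) (by simp)] at this

lemma integral_abs_pow_three_gaussianReal (v : NNReal) :
    ∫ y, |y| ^ 3 ∂(gaussianReal 0 v) = √v ^ 3 * ∫ y, |y| ^ 3 ∂(gaussianReal 0 1) := by
  have e : gaussianReal 0 v = (gaussianReal 0 1).map (√v * ·) := by
    rw [gaussianReal_map_const_mul]
    congr 1
    · simp
    · ext; simp
  rw [e, integral_map (by fun_prop) (by fun_prop), ← integral_const_mul]
  simp only [abs_mul, mul_pow, abs_of_nonneg (Real.sqrt_nonneg _)]

lemma IsCoinTossing.integral_comp {Ω : Type*} [MeasurableSpace Ω] {P : Measure Ω}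
    [IsProbabilityMeasure P] {X : ℕ → Ω → ℝ} {p : ℝ} (hp0 : 0 ≤ p) (hX : IsCoinTossing P X p)
    (l : ℕ) (g : ℝ → ℝ) : ∫ ω, g (X l ω) ∂P = p * g 1 + (1 - p) * g 0 := by
  have hs : MeasurableSet {ω | X l ω = 1} := hX.measurable l (measurableSet_singleton 1)
  have e : (fun ω => g (X l ω)) =
      fun ω => g 0 + {ω | X l ω = 1}.indicator (fun _ => g 1 - g 0) ω := by
    funext ω
    rcases hX.mem_zero_one l ω with h | h <;> simp [Set.indicator, h]
  rw [e, integral_add (integrable_const _) ((integrable_const _).indicator hs),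
    integral_indicator_const _ hs, measureReal_def, hX.prob_one, ENNReal.toReal_ofReal hp0]
  simp only [integral_const, probReal_univ, smul_eq_mul, one_mul]
  ring

/-- The summands of the normalized sum of `m` tosses. -/
noncomputable def normalizedToss {Ω : Type*} (X : ℕ → Ω → ℝ) (p : ℝ) (m l : ℕ) (ω : Ω) : ℝ :=
  (X l ω - p) / √(m * p * (1 - p))

lemma normalizedSum_eq_sum {Ω : Type*} (X : ℕ → Ω → ℝ) (p : ℝ) (m : ℕ) :
    normalizedSum X p m = ∑ l ∈ Finset.range m, normalizedToss X p m l := by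
  funext ω
  simp [normalizedSum, normalizedToss, Finset.sum_apply, ← Finset.sum_div]

namespace IsCoinTossing

variable {Ω : Type*} [MeasurableSpace Ω] {P : Measure Ω} {X : ℕ → Ω → ℝ} {p : ℝ} {m : ℕ}

lemma measurable_normalizedToss (hX : IsCoinTossing P X p) (l : ℕ) :
    Measurable (normalizedToss X p m l) :=
  ((hX.measurable l).sub_const p).div_const _

lemma measurable_sum_normalizedToss (hX : IsCoinTossing P X p) (k : ℕ) :
    Measurable (∑ l ∈ Finset.range k, normalizedToss X p m l) :=
  Finset.sum_fn (Finset.range k) (normalizedToss X p m) ▸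
    Finset.measurable_sum _ fun l _ => hX.measurable_normalizedToss l

lemma abs_normalizedToss_le (hX : IsCoinTossing P X p) (hp0 : 0 < p) (hp1 : p < 1) (l : ℕ) (ω : Ω) :
    |normalizedToss X p m l ω| ≤ (√(m * p * (1 - p)))⁻¹ := by
  rw [normalizedToss, abs_div, abs_of_nonneg (Real.sqrt_nonneg _), div_eq_mul_inv]
  refine mul_le_of_le_one_left (by positivity) (abs_le.2 ?_)
  rcases hX.mem_zero_one l ω with h | h <;> rw [h] <;> constructor <;> linarith

variable [IsProbabilityMeasure P]

lemma integral_map_normalizedToss (hX : IsCoinTossing P X p) (hp0 : 0 < p) (l : ℕ) :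
    ∫ y, y ∂(P.map (normalizedToss X p m l)) = 0 := by
  rw [integral_map (hX.measurable_normalizedToss l).aemeasurable (by fun_prop)]
  exact (hX.integral_comp hp0.le l fun y => (y - p) / √(m * p * (1 - p))).trans (by ring)

lemma integral_sq_map_normalizedToss (hX : IsCoinTossing P X p) (hp0 : 0 < p) (hp1 : p < 1)
    (hm : 0 < m) (l : ℕ) : ∫ y, y ^ 2 ∂(P.map (normalizedToss X p m l)) = (m : ℝ)⁻¹ := by
  have hq : 0 < 1 - p := sub_pos.2 hp1
  have hm' : (0 : ℝ) < m := Nat.cast_pos.2 hm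
  rw [integral_map (hX.measurable_normalizedToss l).aemeasurable (by fun_prop)]
  refine (hX.integral_comp hp0.le l fun y => ((y - p) / √(m * p * (1 - p))) ^ 2).trans ?_
  simp only [div_pow]
  rw [Real.sq_sqrt (by positivity)]
  field_simp
  ring

lemma memLp_map_normalizedToss (hX : IsCoinTossing P X p) (hp0 : 0 < p) (hp1 : p < 1) (l : ℕ) :
    MemLp id 3 (P.map (normalizedToss X p m l)) := by
  rw [memLp_map_measure_iff (by fun_prop) (hX.measurable_normalizedToss l).aemeasurable]
  exact MemLp.of_bound (hX.measurable_normalizedToss l).aestronglyMeasurable _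
    (.of_forall (hX.abs_normalizedToss_le hp0 hp1 l))

lemma integral_abs_pow_three_map_normalizedToss_le (hX : IsCoinTossing P X p) (hp0 : 0 < p)
    (hp1 : p < 1) (l : ℕ) :
    ∫ y, |y| ^ 3 ∂(P.map (normalizedToss X p m l)) ≤ (√(m * p * (1 - p)))⁻¹ ^ 3 := by
  rw [integral_map (hX.measurable_normalizedToss l).aemeasurable (by fun_prop)]
  refine (le_abs_self _).trans ?_
  simpa [-inv_pow] using norm_integral_le_of_norm_le_const (μ := P)
    (f := fun ω => |normalizedToss X p m l ω| ^ 3) (C := (√(m * p * (1 - p)))⁻¹ ^ 3)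
    (.of_forall fun ω => by
      rw [Real.norm_eq_abs, abs_of_nonneg (by positivity)]
      gcongr
      exact hX.abs_normalizedToss_le hp0 hp1 l ω)

lemma map_sum_normalizedToss_succ (hX : IsCoinTossing P X p) (k : ℕ) :
    P.map (∑ l ∈ Finset.range (k + 1), normalizedToss X p m l) =
      P.map (∑ l ∈ Finset.range k, normalizedToss X p m l) ∗ P.map (normalizedToss X p m k) := by
  have hind : iIndepFun (normalizedToss X p m) P :=
    hX.indep.comp (fun _ y => (y - p) / √(m * p * (1 - p))) fun _ => by fun_prop
  rw [Finset.sum_range_succ]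
  exact (hind.indepFun_sum_range_succ hX.measurable_normalizedToss k).map_add_eq_map_conv_map
    (hX.measurable_sum_normalizedToss k)
    (hX.measurable_normalizedToss k)

/-- Quantitative central limit theorem for a test function with a cubic Taylor remainder. -/
lemma abs_integral_normalizedSum_sub_le_of_hasCubicRemainder (hX : IsCoinTossing P X p)
    (hp0 : 0 < p) (hp1 : p < 1) (hm : 0 < m) {h h₁ h₂ : ℝ → ℝ} {B M : ℝ} (hc : Continuous h)
    (hM : ∀ x, |h x| ≤ M) (hB : HasCubicRemainder B h h₁ h₂) :
    |∫ x, h x ∂(P.map (normalizedSum X p m)) - ∫ x, h x ∂(gaussianReal 0 1)| ≤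
      B * ((√(p * (1 - p)))⁻¹ ^ 3 + ∫ y, |y| ^ 3 ∂(gaussianReal 0 1)) / √m := by
  have hm' : (0 : ℝ) < m := Nat.cast_pos.2 hm
  have hB0 : 0 ≤ B := by simpa using (abs_nonneg _).trans (hB 0 1)
  set K : ℝ := ∫ y, |y| ^ 3 ∂(gaussianReal 0 1) with hK
  have hprob (k : ℕ) : IsProbabilityMeasure (P.map (normalizedToss X p m k)) :=
    Measure.isProbabilityMeasure_map (hX.measurable_normalizedToss k).aemeasurable
  have hprob' (k : ℕ) :
      IsProbabilityMeasure (P.map (∑ l ∈ Finset.range k, normalizedToss X p m l)) :=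
    Measure.isProbabilityMeasure_map
      (hX.measurable_sum_normalizedToss _).aemeasurable
  have step (k : ℕ) (x : ℝ) : |∫ y, h (x + y) ∂(P.map (normalizedToss X p m k)) -
      ∫ y, h (x + y) ∂(gaussianReal 0 (m : NNReal)⁻¹)| ≤
        B * (√(p * (1 - p)))⁻¹ ^ 3 / √m ^ 3 + B * K / √m ^ 3 := by
    have a := abs_integral_sub_le_of_hasCubicRemainder hc hM hB
      (hX.memLp_map_normalizedToss hp0 hp1 k) (hX.integral_map_normalizedToss (m := m) hp0 k) x
    have b := abs_integral_sub_le_of_hasCubicRemainder hc hM hB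
      (memLp_id_gaussianReal' (μ := 0) (v := (m : NNReal)⁻¹) 3 (by norm_num)) (by simp) x
    rw [hX.integral_sq_map_normalizedToss hp0 hp1 hm] at a
    rw [integral_sq_gaussianReal, integral_abs_pow_three_gaussianReal, ← hK, abs_sub_comm] at b
    push_cast at b
    refine (abs_sub_le _ _ _).trans (add_le_add (a.trans ?_) (b.trans_eq ?_))
    · refine (mul_le_mul_of_nonneg_left
        (hX.integral_abs_pow_three_map_normalizedToss_le hp0 hp1 k) hB0).trans_eq ?_
      rw [mul_assoc, Real.sqrt_mul hm'.le, mul_inv, mul_pow]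
      field_simp
    · rw [Real.sqrt_inv]
      field_simp
  have main := abs_integral_conv_pow_sub_le hc hM
    (S := fun k => P.map (∑ l ∈ Finset.range k, normalizedToss X p m l))
    (G := fun k => gaussianReal 0 (k * (m : NNReal)⁻¹))
    (ν := fun k => P.map (normalizedToss X p m k)) (γ := fun _ => gaussianReal 0 (m : NNReal)⁻¹)
    -- At stage `0` both laws are the Dirac mass at `0`: the empty sum and the Gaussian of variance
    -- `0`.
    (by
      have : (0 : Ω → ℝ) = fun _ => 0 := rfl
      simp [this, Measure.map_const])
    (fun k => hX.map_sum_normalizedToss_succ k)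
    (fun k => by rw [gaussianReal_conv_gaussianReal]; push_cast; congr 1 <;> ring)
    step m 0
  have h1 : (m : NNReal) * (m : NNReal)⁻¹ = 1 := mul_inv_cancel₀ (by exact_mod_cast hm.ne')
  simp only [zero_add, h1, ← normalizedSum_eq_sum] at main
  refine main.trans_eq ?_
  have hs : (m : ℝ) = √m ^ 2 := (Real.sq_sqrt hm'.le).symm
  have hs0 : 0 < √(m : ℝ) := Real.sqrt_pos.2 hm'
  calc (m : ℝ) * (B * (√(p * (1 - p)))⁻¹ ^ 3 / √m ^ 3 + B * K / √m ^ 3)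
      = √m ^ 2 * (B * (√(p * (1 - p)))⁻¹ ^ 3 / √m ^ 3 + B * K / √m ^ 3) := by rw [← hs]
    _ = _ := by field_simp

/-- Quantitative central limit theorem for a bounded continuous test function with given
oscillation. -/
lemma abs_integral_normalizedSum_sub_le (hX : IsCoinTossing P X p) (hp0 : 0 < p) (hp1 : p < 1)
    (hm : 0 < m) {f : ℝ → ℝ} (hf : Continuous f) {M s ε : ℝ} (hs : 0 < s) (hM : ∀ x, |f x| ≤ M)
    (hε : ∀ x y, |x - y| ≤ 3 * s → |f x - f y| ≤ ε) :
    |∫ x, f x ∂(P.map (normalizedSum X p m)) - ∫ x, f x ∂(gaussianReal 0 1)| ≤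
      2 * ε + 8 * M / s ^ 3 *
        ((√(p * (1 - p)))⁻¹ ^ 3 + ∫ y, |y| ^ 3 ∂(gaussianReal 0 1)) / √m := by
  obtain ⟨h, h₁, h₂, hc, hhM, happ, hrem⟩ := exists_hasCubicRemainder_approx hf hs hM hε
  have : IsProbabilityMeasure (P.map (normalizedSum X p m)) := by
    rw [normalizedSum_eq_sum]
    exact Measure.isProbabilityMeasure_map
      (hX.measurable_sum_normalizedToss _).aemeasurable
  have hint {g : ℝ → ℝ} (hg : Continuous g) (hgM : ∀ x, |g x| ≤ M) (μ : Measure ℝ)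
      [IsProbabilityMeasure μ] : Integrable g μ :=
    Integrable.of_bound hg.aestronglyMeasurable M (.of_forall hgM)
  have a := abs_integral_sub_integral_le (hint hc hhM (P.map (normalizedSum X p m)))
    (hint hf hM _) happ
  have b := abs_integral_sub_integral_le (hint hc hhM (gaussianReal 0 1)) (hint hf hM _) happ
  have c := hX.abs_integral_normalizedSum_sub_le_of_hasCubicRemainder hp0 hp1 hm hc hhM hrem
  rw [abs_le] at a b c ⊢
  constructor <;> linarith [a.1, a.2, b.1, b.2, c.1, c.2]

end IsCoinTossing

/-! ### Global bounds from modulus and support -/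

/-- The margin `1` in the radius absorbs `δ ≤ 1`: if one point leaves `[-(R + 1), R + 1]`, the other
is still where `f` vanishes. -/
lemma abs_sub_lt_of_modulus_of_support {f : ℝ → ℝ} {R : ℕ} {δ ε : ℝ} (hδ : δ ≤ 1) (hε : 0 < ε)
    (hf : ∀ x y : ℝ, |x| ≤ (R + 1 : ℕ) → |y| ≤ (R + 1 : ℕ) → |x - y| < δ → |f x - f y| < ε)
    (hR : ∀ x : ℝ, (R : ℝ) ≤ |x| → f x = 0) {x y : ℝ} (hxy : |x - y| < δ) : |f x - f y| < ε := by
  push_cast at hf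
  by_cases h : |x| ≤ R + 1 ∧ |y| ≤ R + 1
  · exact hf x y h.1 h.2 hxy
  · have h1 := abs_sub_abs_le_abs_sub x y
    have h2 := abs_sub_abs_le_abs_sub y x
    rw [abs_sub_comm y x] at h2
    rw [not_and_or, not_le, not_le] at h
    rw [hR x (by rcases h with h | h <;> linarith), hR y (by rcases h with h | h <;> linarith)]
    simpa using hε

lemma continuous_of_forall_modulus {f : ℝ → ℝ} (δ : ℕ → ℝ) (hδ : ∀ k, 0 < δ k)
    (hf : ∀ k x y, |x - y| < δ k → |f x - f y| < (2 : ℝ)⁻¹ ^ k) : Continuous f := by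
  refine Metric.continuous_iff.2 fun x ε hε => ?_
  obtain ⟨k, hk⟩ := exists_pow_lt_of_lt_one hε (show (2 : ℝ)⁻¹ < 1 by norm_num)
  exact ⟨δ k, hδ k, fun y hy => (hf k y x hy).trans hk⟩

/-- From any point of the support, `N` steps of length `s` to the right reach the zero region, and
`f` changes by at most `ε` per step. This gives an explicit sup bound where compactness would give
none. -/
lemma abs_le_mul_of_modulus_of_support {f : ℝ → ℝ} {R s ε : ℝ}
    (hf : ∀ x, |f x - f (x + s)| ≤ ε) (hR : ∀ x, R ≤ |x| → f x = 0) {N : ℕ} (hN : 2 * R ≤ N * s)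
    (x : ℝ) : |f x| ≤ N * ε := by
  have hε : 0 ≤ ε := (abs_nonneg _).trans (hf 0)
  have walk (j : ℕ) : ∀ x, R ≤ x + j * s → |f x| ≤ j * ε := by
    induction j with
    | zero =>
      intro x hx
      rw [hR x ((by simpa using hx : R ≤ x).trans (le_abs_self x))]
      simp
    | succ j ih =>
      intro x hx
      push_cast at hx ⊢
      have h1 := ih (x + s) (by linarith)
      have h2 := hf x
      rw [abs_le] at h1 h2 ⊢
      constructor <;> linarith [h1.1, h1.2, h2.1, h2.2]
  by_cases hx : R ≤ |x|
  · rw [hR x hx]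
    simpa using by positivity
  · exact walk N x (by linarith [neg_abs_le x])

/-! ### The recursive stage of convergence -/

lemma Primrec.two_pow : Primrec fun n : ℕ => 2 ^ n := by
  refine (Primrec.nat_rec₁ 1 (Primrec.nat_double.comp₂ Primrec₂.right)).of_eq fun n => ?_
  induction n with
  | zero => rfl
  | succ n ih => rw [pow_succ', ← ih]

/-- A stage from which on the error is below `2 ^ (-k)`, for a test function supported in `[-R, R]`
with modulus of continuity `d`, and a Berry–Esseen type constant `c`. -/
def convergenceStage (c R d k : ℕ) : ℕ :=
  (8 * R * (2 ^ (d + 2) * 2 ^ (d + 2) * (2 ^ (d + 2) * 2 ^ (d + 2))) * c * 2 ^ (k + 1)) *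
    (8 * R * (2 ^ (d + 2) * 2 ^ (d + 2) * (2 ^ (d + 2) * 2 ^ (d + 2))) * c * 2 ^ (k + 1)) + 1

lemma computable_convergenceStage {ι : Type*} [Primcodable ι] (c : ℕ) {R d k : ι → ℕ}
    (hR : Computable R) (hd : Computable d) (hk : Computable k) :
    Computable fun i => convergenceStage c (R i) (d i) (k i) := by
  have add {a b : ι → ℕ} (ha : Computable a) (hb : Computable b) :
    Computable fun i => a i + b i := Primrec.nat_add.to_comp.comp ha hb
  have mul {a b : ι → ℕ} (ha : Computable a) (hb : Computable b) :
    Computable fun i => a i * b i := Primrec.nat_mul.to_comp.comp ha hb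
  have pow {a : ι → ℕ} (ha : Computable a) :
    Computable fun i => 2 ^ a i := Primrec.two_pow.to_comp.comp ha
  have hD := pow (add hd (.const 2))
  have hA := mul (mul (mul (mul (.const 8) hR) (mul (mul hD hD) (mul hD hD))) (.const c))
    (pow (add hk (.const 1)))
  exact add (mul hA hA) (.const 1)

theorem theorem5p1 {Ω : Type*} [MeasurableSpace Ω] (P : Measure Ω) [IsProbabilityMeasure P]
    (X : ℕ → Ω → ℝ) (p : ℝ) (hp0 : 0 < p) (hp1 : p < 1) (hp : IsComputableReal p)
    (hX : IsCoinTossing P X p) :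
    ConvergesEffectively (fun m => P.map (normalizedSum X p m)) (gaussianReal 0 1) := by
  rintro f ⟨hf, ρ, hρ, hsupp⟩
  obtain ⟨β, hβ, hmod⟩ := hf.effectively_continuous
  set C : ℝ := (√(p * (1 - p)))⁻¹ ^ 3 + ∫ y, |y| ^ 3 ∂(gaussianReal 0 1) with hC
  obtain ⟨c, hc⟩ := exists_nat_ge C
  have hosc (n k : ℕ) (x y : ℝ) (hxy : |x - y| < (2 : ℝ)⁻¹ ^ β (n, ρ n + 1, k)) :
      |f n x - f n y| < (2 : ℝ)⁻¹ ^ k :=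
    abs_sub_lt_of_modulus_of_support (pow_le_one₀ (by norm_num) (by norm_num)) (by positivity)
      (hmod n (ρ n + 1) k) (hsupp n) hxy
  -- Precision `k + 2` makes the smoothing error `2 * ε` equal to half of `2 ^ (-k)`; the other half
  -- is for the `1 / √m` term.
  refine ⟨fun i => convergenceStage c (ρ i.1) (β (i.1, ρ i.1 + 1, i.2 + 2)) i.2, ?_, ?_⟩
  · have hρ' : Computable fun i : ℕ × ℕ => ρ i.1 := hρ.comp .fst
    exact computable_convergenceStage c hρ' (hβ.comp (Computable.fst.pair
      ((Computable.succ.comp hρ').pair (Computable.succ.comp (Computable.succ.comp .snd))))) .snd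
  · intro n k m hm
    dsimp only at hm
    set d := β (n, ρ n + 1, k + 2)
    have hcont : Continuous (f n) :=
      continuous_of_forall_modulus _ (fun k => by positivity) (hosc n)
    -- The width is `s = 2 ^ (-(d + 2))`, so that `3 * s` lies below the modulus `2 ^ (-d)`.
    have hs : (0 : ℝ) < (2 : ℝ)⁻¹ ^ (d + 2) := by positivity
    have hsd : 3 * (2 : ℝ)⁻¹ ^ (d + 2) < (2 : ℝ)⁻¹ ^ d := by
      rw [pow_add]
      have : (0 : ℝ) < (2 : ℝ)⁻¹ ^ d := by positivity
      linarith
    have hε (x y : ℝ) (hxy : |x - y| ≤ 3 * (2 : ℝ)⁻¹ ^ (d + 2)) :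
        |f n x - f n y| ≤ (2 : ℝ)⁻¹ ^ (k + 2) := (hosc n (k + 2) x y (hxy.trans_lt hsd)).le
    have hM (x : ℝ) : |f n x| ≤ ρ n * 2 ^ (d + 2) := by
      have := abs_le_mul_of_modulus_of_support (N := 2 * ρ n * 2 ^ (d + 2))
        (fun x => hε x _ (by rw [sub_add_cancel_left, abs_neg, abs_of_pos hs]; linarith)) (hsupp n)
        (by push_cast; rw [mul_assoc _ (2 ^ _) _, ← mul_pow]; norm_num) x
      refine this.trans ?_
      have h2 : (2 : ℝ)⁻¹ ^ (k + 2) ≤ 1 / 2 := by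
        rw [pow_add]
        have : (2 : ℝ)⁻¹ ^ k ≤ 1 := pow_le_one₀ (by norm_num) (by norm_num)
        linarith
      push_cast
      calc (2 * ρ n * 2 ^ (d + 2) : ℝ) * (2 : ℝ)⁻¹ ^ (k + 2)
          ≤ 2 * ρ n * 2 ^ (d + 2) * (1 / 2) := by gcongr
        _ = _ := by ring
    have hm0 : 0 < m := lt_of_lt_of_le (Nat.succ_pos _) hm
    refine (hX.abs_integral_normalizedSum_sub_le hp0 hp1 hm0 hcont hs hM hε).trans_lt ?_
    rw [← hC]
    have hm' : (0 : ℝ) < √m := Real.sqrt_pos.2 (Nat.cast_pos.2 hm0)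
    -- The stage is the square of this left-hand side plus one. Of the four factors `2 ^ (d + 2)`,
    -- three come from `s ^ (-3)` and one from the sup bound.
    have hlt : (8 * ρ n * (2 ^ (d + 2)) ^ 4 * c * 2 ^ (k + 1) : ℝ) < √m := by
      refine Real.lt_sqrt_of_sq_lt ?_
      have : (convergenceStage c (ρ n) d k : ℝ) ≤ m := Nat.cast_le.2 hm
      rw [convergenceStage] at this
      push_cast at this
      refine lt_of_lt_of_le (lt_add_one _) (le_trans (le_of_eq ?_) this)
      ring
    have hlast : 8 * (ρ n * 2 ^ (d + 2)) / ((2 : ℝ)⁻¹ ^ (d + 2)) ^ 3 * C / √m <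
        (2 : ℝ)⁻¹ ^ (k + 1) := by
      rw [div_lt_iff₀ hm']
      calc 8 * (ρ n * 2 ^ (d + 2)) / ((2 : ℝ)⁻¹ ^ (d + 2)) ^ 3 * C
          ≤ 8 * (ρ n * 2 ^ (d + 2)) / ((2 : ℝ)⁻¹ ^ (d + 2)) ^ 3 * c := by gcongr
        _ = (2 : ℝ)⁻¹ ^ (k + 1) * (8 * ρ n * (2 ^ (d + 2)) ^ 4 * c * 2 ^ (k + 1)) := by
          have h1 : (2 : ℝ)⁻¹ ^ (k + 1) * 2 ^ (k + 1) = 1 := by rw [← mul_pow]; norm_num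
          rw [inv_pow 2 (d + 2), inv_pow, div_inv_eq_mul]
          linear_combination -(8 * ρ n * (2 ^ (d + 2)) ^ 4 * c) * h1
        _ < (2 : ℝ)⁻¹ ^ (k + 1) * √m := by gcongr
    have h4 : 2 * (2 : ℝ)⁻¹ ^ (k + 2) = (2 : ℝ)⁻¹ ^ (k + 1) := by ring
    have h5 : (2 : ℝ)⁻¹ ^ k = (2 : ℝ)⁻¹ ^ (k + 1) + (2 : ℝ)⁻¹ ^ (k + 1) := by ring
    rw [h4, h5]
    linarith
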